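/- Let $n\ge 2$ be an integer and $b_1,b_2\in\mathbb{R}$. Let $F_n$ be the real symmetric $n\times n$ matrix whose entries in positions $(i,i+1)$ and $(i+1,i)$, $1\le i\le n-1$, are $1$ and whose other entries are all $0$ (the free discrete Schrödinger matrix). Let $S_{n,2}$ be the matrix obtained from $F_n$ by replacing the first two diagonal entries by $b_1$ and $b_2$. Let $\lambda_1<\lambda_2<\dots<\lambda_n$ be the eigenvalues of $F_n$ and let $\tilde\lambda_1<\tilde\lambda_2<\dots<\tilde\lambda_n$ be the eigenvalues of $S_{n,2}$. (Each matrix has $n$ distinct real eigenvalues.) If $\lambda_k=\tilde\lambda_k$ and $\lambda_{k+1}=\tilde\lambda_{k+1}$ for some $k\in\{1,2,\dots,n-1\}$, then $b_1=0$ and $b_2=0$, i.e. $S_{n,2}=F_n$. -/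

import Mathlib

/-- The `n × n` discrete Schrödinger matrix with diagonal `b`: the entries next to the diagonal are
`1`, all remaining off-diagonal entries are `0`. -/
def schrodingerMatrix (n : ℕ) (b : Fin n → ℝ) : Matrix (Fin n) (Fin n) ℝ :=
  Matrix.of fun i j =>
    if i = j then b i
    else if i.val + 1 = j.val ∨ j.val + 1 = i.val then 1
    else 0

/-- The free discrete Schrödinger matrix `F_n` (zero diagonal). -/
def freeMatrix (n : ℕ) : Matrix (Fin n) (Fin n) ℝ :=
  schrodingerMatrix n fun _ => 0

/-- The matrix `S_{n,2}`: diagonal `b₁, b₂, 0, …, 0` (positions are counted from `0` here). -/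
def mixedMatrix (n : ℕ) (b₁ b₂ : ℝ) : Matrix (Fin n) (Fin n) ℝ :=
  schrodingerMatrix n fun i => if i.val = 0 then b₁ else if i.val = 1 then b₂ else 0

theorem schrodingerMatrix_isHermitian (n : ℕ) (b : Fin n → ℝ) :
    (schrodingerMatrix n b).IsHermitian := by
  ext i j
  by_cases h : i = j
  · subst h
    simp [schrodingerMatrix]
  · have h' : ¬ j = i := fun e => h e.symm
    simp [schrodingerMatrix, h, h', or_comm]

theorem freeMatrix_isHermitian (n : ℕ) : (freeMatrix n).IsHermitian :=
  schrodingerMatrix_isHermitian n _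

theorem mixedMatrix_isHermitian (n : ℕ) (b₁ b₂ : ℝ) : (mixedMatrix n b₁ b₂).IsHermitian :=
  schrodingerMatrix_isHermitian n _

/-- The eigenvalues of a real symmetric `n × n` matrix, repeated according to multiplicity and
listed in increasing order; the index `k : Fin n` gives the eigenvalue in position `k + 1`.
(Mathlib's `eigenvalues₀` lists them in decreasing order, hence the reversal.) -/
noncomputable def increasingEigenvalues {n : ℕ} {A : Matrix (Fin n) (Fin n) ℝ}
    (hA : A.IsHermitian) (k : Fin n) : ℝ :=
  hA.eigenvalues₀ (Fin.cast (Fintype.card_fin n).symm k.rev)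

theorem increasingEigenvalues_monotone {n : ℕ} {A : Matrix (Fin n) (Fin n) ℝ}
    (hA : A.IsHermitian) : Monotone (increasingEigenvalues hA) := by
  intro i j hij
  apply hA.eigenvalues₀_antitone
  have h := Fin.rev_le_rev.mpr hij
  exact h

theorem charpoly_eq_prod_increasingEigenvalues {n : ℕ} {A : Matrix (Fin n) (Fin n) ℝ}
    (hA : A.IsHermitian) :
    A.charpoly = ∏ k : Fin n, (Polynomial.X - Polynomial.C (increasingEigenvalues hA k)) := by
  rw [hA.charpoly_eq]
  let e : Fin n ≃ Fin n :=
    (((Fintype.equivOfCardEq (Fintype.card_fin _)).symm.trans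
      (finCongr (Fintype.card_fin n))).trans Fin.revPerm)
  refine Fintype.prod_equiv e _ _ fun i => ?_
  simp [increasingEigenvalues, Matrix.IsHermitian.eigenvalues, e]

/-! A common eigenvalue of `F_n` and `S_{n,2}` is a root of `b₂ x² - b₁ b₂ x + b₁`
(`quadratic_of_common_eigenvalue`). If `b₂ = 0`, this gives `b₁ = 0`. Otherwise the two shared
eigenvalues `x < y` satisfy `x + y = b₁` and `b₂ x y = b₁`, and the sign of `x y` decides. If `x y >
0`, then `b₁` and `b₂` have the same sign and strict eigenvalue comparison excludes any coincidence
at equal positions (`increasingEigenvalues_ne_of_pos_or_neg`). If `x y < 0`, symmetry of the free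
spectrum gives `y = -x` (`add_eq_zero_of_consecutive_freeMatrix`), so `b₁ = 0`; if `x y = 0`, again
`b₁ = 0`. But `b₁ = 0` with `b₂ ≠ 0` forces `x = y = 0`. -/

/-! ### Eigenbases and comparison of two spectra. -/

open Matrix in
/-- The eigenvectors of a real symmetric matrix, in the order of `increasingEigenvalues`, form an
orthonormal basis. -/
theorem exists_increasing_eigenbasis {n : ℕ} {A : Matrix (Fin n) (Fin n) ℝ} (hA : A.IsHermitian) :
    ∃ e : Fin n → Fin n → ℝ, (∀ i j, e i ⬝ᵥ e j = if i = j then 1 else 0) ∧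
      (∀ v : Fin n → ℝ, v = ∑ j, (e j ⬝ᵥ v) • e j) ∧
      ∀ j, A *ᵥ e j = increasingEigenvalues hA j • e j := by
  let σ : Fin n ≃ Fin n :=
    (((Fintype.equivOfCardEq (Fintype.card_fin _)).symm.trans
      (finCongr (Fintype.card_fin n))).trans Fin.revPerm)
  have hσ : ∀ i, hA.eigenvalues i = increasingEigenvalues hA (σ i) := fun i => by
    simp [increasingEigenvalues, Matrix.IsHermitian.eigenvalues, σ]
  let b := hA.eigenvectorBasis.reindex σ
  have hin : ∀ x y : EuclideanSpace ℝ (Fin n), inner ℝ x y = x.ofLp ⬝ᵥ y.ofLp := fun x y => by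
    rw [EuclideanSpace.inner_eq_star_dotProduct, dotProduct_comm]
    simp
  refine ⟨fun j => (b j).ofLp, fun i j => ?_, fun v => ?_, fun j => ?_⟩
  · rw [← hin, b.inner_eq_ite]
  · have h := congrArg WithLp.ofLp (b.sum_repr' (WithLp.toLp 2 v))
    simp only [hin, WithLp.ofLp_sum, WithLp.ofLp_smul] at h
    exact h.symm
  · have h := hA.mulVec_eigenvectorBasis (σ.symm j)
    rw [hσ, σ.apply_symm_apply] at h
    simpa [b] using h

open Matrix in
theorem mulVec_eq_sum_of_eigenbasis {n : ℕ} {A : Matrix (Fin n) (Fin n) ℝ} {d : Fin n → ℝ}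
    {e : Fin n → Fin n → ℝ} (hsum : ∀ v : Fin n → ℝ, v = ∑ j, (e j ⬝ᵥ v) • e j)
    (hev : ∀ j, A *ᵥ e j = d j • e j) (v : Fin n → ℝ) :
    A *ᵥ v = ∑ j, (d j * (e j ⬝ᵥ v)) • e j := by
  conv_lhs => rw [hsum v]
  rw [mulVec_sum]
  refine Finset.sum_congr rfl fun j _ => ?_
  rw [mulVec_smul, hev, smul_smul, mul_comm]

open Matrix in
theorem mulVec_sub_smul_eq_sum_of_eigenbasis {n : ℕ} {A : Matrix (Fin n) (Fin n) ℝ}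
    {d : Fin n → ℝ} {e : Fin n → Fin n → ℝ} (hsum : ∀ v : Fin n → ℝ, v = ∑ j, (e j ⬝ᵥ v) • e j)
    (hev : ∀ j, A *ᵥ e j = d j • e j) (v : Fin n → ℝ) (x : ℝ) :
    A *ᵥ v - x • v = ∑ j, ((d j - x) * (e j ⬝ᵥ v)) • e j := by
  rw [mulVec_eq_sum_of_eigenbasis hsum hev]
  have h : x • v = ∑ j, (x * (e j ⬝ᵥ v)) • e j := by
    conv_lhs => rw [hsum v]
    simp only [Finset.smul_sum, smul_smul]
  simp only [h, ← Finset.sum_sub_distrib, ← sub_smul, ← sub_mul]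

open Matrix in
theorem dotProduct_mulVec_sub_smul_of_eigenbasis {n : ℕ} {A : Matrix (Fin n) (Fin n) ℝ}
    {d : Fin n → ℝ} {e : Fin n → Fin n → ℝ} (hsum : ∀ v : Fin n → ℝ, v = ∑ j, (e j ⬝ᵥ v) • e j)
    (hev : ∀ j, A *ᵥ e j = d j • e j) (v : Fin n → ℝ) (x : ℝ) :
    v ⬝ᵥ A *ᵥ v - x * (v ⬝ᵥ v) = ∑ j, (d j - x) * (e j ⬝ᵥ v) ^ 2 := by
  have h := congrArg (v ⬝ᵥ ·) (mulVec_sub_smul_eq_sum_of_eigenbasis hsum hev v x)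
  simp only [dotProduct_sub, dotProduct_smul, dotProduct_sum, smul_eq_mul] at h
  rw [h]
  refine Finset.sum_congr rfl fun j _ => ?_
  rw [dotProduct_comm v (e j)]
  ring

open Matrix in
/-- If the quadratic form `A - x` is a combination of squares with coefficients of one sign and
vanishes at `v`, then `v` lies in the eigenspace of `x`. -/
theorem mulVec_eq_smul_of_eigenbasis {n : ℕ} {A : Matrix (Fin n) (Fin n) ℝ}
    {d : Fin n → ℝ} {e : Fin n → Fin n → ℝ} (hsum : ∀ v : Fin n → ℝ, v = ∑ j, (e j ⬝ᵥ v) • e j)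
    (hev : ∀ j, A *ᵥ e j = d j • e j) {v : Fin n → ℝ} {x : ℝ}
    (hsign : (∀ j, 0 ≤ (d j - x) * (e j ⬝ᵥ v) ^ 2) ∨ ∀ j, (d j - x) * (e j ⬝ᵥ v) ^ 2 ≤ 0)
    (hv : v ⬝ᵥ A *ᵥ v = x * (v ⬝ᵥ v)) : A *ᵥ v = x • v := by
  have h0 := dotProduct_mulVec_sub_smul_of_eigenbasis hsum hev v x
  rw [hv, sub_self] at h0
  have hz : ∀ j, (d j - x) * (e j ⬝ᵥ v) ^ 2 = 0 := by
    rcases hsign with h | h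
    · intro j
      exact (Finset.sum_eq_zero_iff_of_nonneg fun j _ => h j).mp h0.symm j (Finset.mem_univ j)
    · intro j
      exact (Finset.sum_eq_zero_iff_of_nonpos fun j _ => h j).mp h0.symm j (Finset.mem_univ j)
  rw [← sub_eq_zero, mulVec_sub_smul_eq_sum_of_eigenbasis hsum hev]
  refine Finset.sum_eq_zero fun j _ => ?_
  rcases mul_eq_zero.mp (hz j) with h | h
  · rw [h, zero_mul, zero_smul]
  · rw [pow_eq_zero_iff two_ne_zero |>.mp h, mul_zero, zero_smul]

open Matrix in
/-- If two symmetric matrices share the eigenvalue `x` in position `k`, there is a nonzero vector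
at which the form of the first is at least `x` and that of the second is at most `x`; equality
forces an eigenvector. -/
theorem exists_vector_of_increasingEigenvalues_eq {n : ℕ} {A B : Matrix (Fin n) (Fin n) ℝ}
    (hA : A.IsHermitian) (hB : B.IsHermitian) (k : Fin n) {x : ℝ}
    (hxA : increasingEigenvalues hA k = x) (hxB : increasingEigenvalues hB k = x) :
    ∃ v : Fin n → ℝ, v ≠ 0 ∧ x * (v ⬝ᵥ v) ≤ v ⬝ᵥ A *ᵥ v ∧ v ⬝ᵥ B *ᵥ v ≤ x * (v ⬝ᵥ v) ∧
      (v ⬝ᵥ A *ᵥ v = x * (v ⬝ᵥ v) → A *ᵥ v = x • v) ∧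
      (v ⬝ᵥ B *ᵥ v = x * (v ⬝ᵥ v) → B *ᵥ v = x • v) := by
  obtain ⟨e, -, hes, hee⟩ := exists_increasing_eigenbasis hA
  obtain ⟨f, -, hfs, hfe⟩ := exists_increasing_eigenbasis hB
  -- Dimension count: row `k` is zero, so `M` is singular, and a kernel vector is orthogonal to `e
  -- j` for `j < k` and to `f j` for `j > k`.
  let M : Matrix (Fin n) (Fin n) ℝ :=
    Matrix.of fun j => if j < k then e j else if k < j then f j else 0
  have hM : ¬ Function.Injective M.mulVecLin := by
    intro h
    obtain ⟨w, hw⟩ := LinearMap.injective_iff_surjective.mp h (Pi.single k 1)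
    have := congrFun hw k
    simp [M, mulVec] at this
  obtain ⟨v, hv, hv0⟩ : ∃ v, M *ᵥ v = 0 ∧ v ≠ 0 := by
    by_contra! h
    exact hM ((injective_iff_map_eq_zero M.mulVecLin).mpr h)
  have hlow : ∀ j, j < k → e j ⬝ᵥ v = 0 := fun j hj => by
    simpa [M, mulVec, hj] using congrFun hv j
  have hhigh : ∀ j, k < j → f j ⬝ᵥ v = 0 := fun j hj => by
    simpa [M, mulVec, hj, hj.not_gt] using congrFun hv j
  have hsA : ∀ j, 0 ≤ (increasingEigenvalues hA j - x) * (e j ⬝ᵥ v) ^ 2 := fun j => by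
    rcases lt_or_ge j k with hj | hj
    · simp [hlow j hj]
    · exact mul_nonneg (sub_nonneg.mpr (hxA ▸ increasingEigenvalues_monotone hA hj)) (sq_nonneg _)
  have hsB : ∀ j, (increasingEigenvalues hB j - x) * (f j ⬝ᵥ v) ^ 2 ≤ 0 := fun j => by
    rcases lt_or_ge k j with hj | hj
    · simp [hhigh j hj]
    · exact mul_nonpos_of_nonpos_of_nonneg
        (sub_nonpos.mpr (hxB ▸ increasingEigenvalues_monotone hB hj)) (sq_nonneg _)
  refine ⟨v, hv0, ?_, ?_, mulVec_eq_smul_of_eigenbasis hes hee (Or.inl hsA),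
    mulVec_eq_smul_of_eigenbasis hfs hfe (Or.inr hsB)⟩
  · rw [← sub_nonneg, dotProduct_mulVec_sub_smul_of_eigenbasis hes hee]
    exact Finset.sum_nonneg fun j _ => hsA j
  · rw [← sub_nonpos, dotProduct_mulVec_sub_smul_of_eigenbasis hfs hfe]
    exact Finset.sum_nonpos fun j _ => hsB j

open Matrix in
theorem exists_increasingEigenvalues_eq {n : ℕ} {A : Matrix (Fin n) (Fin n) ℝ}
    (hA : A.IsHermitian) {v : Fin n → ℝ} (hv : v ≠ 0) {x : ℝ} (h : A *ᵥ v = x • v) :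
    ∃ j, increasingEigenvalues hA j = x := by
  obtain ⟨e, -, hes, hee⟩ := exists_increasing_eigenbasis hA
  by_contra! hne
  have h1 : ∀ j, e j ⬝ᵥ v = 0 := fun j => by
    have h2 : e j ⬝ᵥ A *ᵥ v = increasingEigenvalues hA j * (e j ⬝ᵥ v) := by
      rw [dotProduct_mulVec, ← mulVec_transpose, ← conjTranspose_eq_transpose_of_trivial, hA.eq,
        hee, smul_dotProduct, smul_eq_mul]
    rw [h, dotProduct_smul, smul_eq_mul] at h2
    have h3 : (increasingEigenvalues hA j - x) * (e j ⬝ᵥ v) = 0 := by linarith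
    exact (mul_eq_zero.mp h3).resolve_left (sub_ne_zero.mpr (hne j))
  exact hv (by rw [hes v]; simp [h1])

open Matrix in
theorem exists_eigenvector_increasingEigenvalues {n : ℕ} {A : Matrix (Fin n) (Fin n) ℝ}
    (hA : A.IsHermitian) (k : Fin n) :
    ∃ v : Fin n → ℝ, v ≠ 0 ∧ A *ᵥ v = increasingEigenvalues hA k • v := by
  obtain ⟨e, heo, -, hee⟩ := exists_increasing_eigenbasis hA
  refine ⟨e k, fun h => ?_, hee k⟩
  simpa [h] using heo k k

/-! ### The three-term recurrence. -/

open Matrix in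
-- Neighbours are written as conditional sums so that a missing neighbour at either end contributes
-- `0`.
theorem schrodingerMatrix_mulVec {n : ℕ} (b v : Fin n → ℝ) (i : Fin n) :
    (schrodingerMatrix n b *ᵥ v) i = b i * v i +
      (∑ j : Fin n, if i.val + 1 = j.val then v j else 0) +
      ∑ j : Fin n, if j.val + 1 = i.val then v j else 0 := by
  have hd : b i * v i = ∑ j : Fin n, if i = j then b j * v j else 0 := by simp
  rw [hd, ← Finset.sum_add_distrib, ← Finset.sum_add_distrib, mulVec, dotProduct]
  refine Finset.sum_congr rfl fun j _ => ?_
  rcases eq_or_ne i j with h | h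
  · subst h
    simp [schrodingerMatrix]
  · by_cases h1 : i.val + 1 = j.val
    · have h2 : ¬ j.val + 1 = i.val := by omega
      simp [schrodingerMatrix, h, h1, h2]
    · simp [schrodingerMatrix, h, h1]

theorem sum_ite_val_eq {n : ℕ} (v : Fin n → ℝ) {m : ℕ} (hm : m < n) :
    (∑ j : Fin n, if m = j.val then v j else 0) = v ⟨m, hm⟩ := by
  rw [Finset.sum_eq_single ⟨m, hm⟩]
  · simp
  · intro j _ hj
    rw [if_neg fun h => hj (Fin.ext h.symm)]
  · simp

theorem sum_ite_succ_eq_succ {n : ℕ} (v : Fin n → ℝ) {m : ℕ} (hm : m < n) :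
    (∑ j : Fin n, if j.val + 1 = m + 1 then v j else 0) = v ⟨m, hm⟩ := by
  rw [← sum_ite_val_eq v hm]
  simp only [Nat.add_right_cancel_iff, eq_comm]

open Matrix in
/-- An eigenvector of a discrete Schrödinger matrix with vanishing first entry is zero. -/
theorem eq_zero_of_schrodingerMatrix_mulVec {n : ℕ} {b v : Fin n → ℝ} {x : ℝ}
    (h : schrodingerMatrix n b *ᵥ v = x • v) (hn : 0 < n) (h0 : v ⟨0, hn⟩ = 0) : v = 0 := by
  have key : ∀ m, ∀ hm : m < n, v ⟨m, hm⟩ = 0 := by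
    intro m
    induction m using Nat.strong_induction_on with
    | _ m ih =>
      intro hm
      rcases m with _ | m
      · exact h0
      have hr := congrFun h ⟨m, by omega⟩
      rw [schrodingerMatrix_mulVec, sum_ite_val_eq v hm, Pi.smul_apply,
        ih m (by omega) (by omega)] at hr
      rw [Finset.sum_eq_zero] at hr
      · simpa using hr
      · intro j _
        split_ifs with hj
        · exact ih j (by simp only at hj; omega) j.isLt
        · rfl
  ext i
  exact key i i.isLt

open Matrix in
/-- If a vector satisfies the eigenvalue equation in the rows from `2` on and its last entry
vanishes, then all its entries but the first vanish. -/
theorem apply_eq_zero_of_schrodingerMatrix_mulVec_tail {n : ℕ} {b v : Fin n → ℝ} {x : ℝ}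
    (h : ∀ i : Fin n, 2 ≤ i.val → (schrodingerMatrix n b *ᵥ v) i = x * v i)
    (hlast : ∀ i : Fin n, i.val + 1 = n → v i = 0) (i : Fin n) (hi : 1 ≤ i.val) : v i = 0 := by
  have key : ∀ m, ∀ i : Fin n, 1 ≤ i.val → i.val + m + 1 = n → v i = 0 := by
    intro m
    induction m using Nat.strong_induction_on with
    | _ m ih =>
      intro i hi him
      rcases m with _ | m
      · exact hlast i (by omega)
      have hr := h ⟨i.val + 1, by omega⟩ (by simp only; omega)
      rw [schrodingerMatrix_mulVec] at hr
      simp only at hr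
      rw [sum_ite_succ_eq_succ v i.isLt,
        ih m (by omega) ⟨i.val + 1, by omega⟩ (by simp only; omega) (by simp only; omega),
        Finset.sum_eq_zero] at hr
      · simpa using hr
      · intro j _
        split_ifs with hj
        · exact ih (m - 1) (by omega) j (by omega) (by omega)
        · rfl
  exact key (n - 1 - i.val) i hi (by omega)

open Matrix in
theorem increasingEigenvalues_schrodingerMatrix_strictMono {n : ℕ} (b : Fin n → ℝ) :
    StrictMono (increasingEigenvalues (schrodingerMatrix_isHermitian n b)) := by
  refine (increasingEigenvalues_monotone _).strictMono_of_injective fun i j hij => ?_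
  by_contra hne
  obtain ⟨e, heo, -, hee⟩ := exists_increasing_eigenbasis (schrodingerMatrix_isHermitian n b)
  have hn : 0 < n := i.pos
  -- This combination has first entry `0`, so the recurrence kills it.
  have h1 : schrodingerMatrix n b *ᵥ (e j ⟨0, hn⟩ • e i - e i ⟨0, hn⟩ • e j) =
      increasingEigenvalues (schrodingerMatrix_isHermitian n b) j •
        (e j ⟨0, hn⟩ • e i - e i ⟨0, hn⟩ • e j) := by
    rw [mulVec_sub, mulVec_smul, mulVec_smul, hee, hee, hij, smul_sub, smul_comm, smul_comm (e i _)]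
  have h2 := eq_zero_of_schrodingerMatrix_mulVec h1 hn (by simp [mul_comm])
  have h3 := congrArg (e i ⬝ᵥ ·) h2
  simp only [dotProduct_sub, dotProduct_smul, heo, if_neg hne] at h3
  have h4 : e j ⟨0, hn⟩ = 0 := by simpa using h3
  have h5 := heo j j
  rw [eq_zero_of_schrodingerMatrix_mulVec (hee j) hn h4] at h5
  simp at h5

/-! ### Common eigenvalues of the free and the perturbed matrix. -/

open Matrix in
theorem mixedMatrix_mulVec (n : ℕ) (b₁ b₂ : ℝ) (v : Fin n → ℝ) (i : Fin n) :
    (mixedMatrix n b₁ b₂ *ᵥ v) i = (freeMatrix n *ᵥ v) i +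
      (if i.val = 0 then b₁ else if i.val = 1 then b₂ else 0) * v i := by
  rw [mixedMatrix, freeMatrix, schrodingerMatrix_mulVec, schrodingerMatrix_mulVec]
  ring

open Matrix in
theorem dotProduct_mixedMatrix_mulVec {n : ℕ} (hn : 1 < n) (b₁ b₂ : ℝ) (v : Fin n → ℝ) :
    v ⬝ᵥ mixedMatrix n b₁ b₂ *ᵥ v = v ⬝ᵥ freeMatrix n *ᵥ v +
      (b₁ * v ⟨0, by omega⟩ ^ 2 + b₂ * v ⟨1, hn⟩ ^ 2) := by
  have h0 : b₁ * v ⟨0, by omega⟩ ^ 2 =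
      ∑ j : Fin n, if 0 = j.val then b₁ * v j ^ 2 else 0 :=
    (sum_ite_val_eq (fun j => b₁ * v j ^ 2) (by omega)).symm
  have h1 : b₂ * v ⟨1, hn⟩ ^ 2 = ∑ j : Fin n, if 1 = j.val then b₂ * v j ^ 2 else 0 :=
    (sum_ite_val_eq (fun j => b₂ * v j ^ 2) hn).symm
  rw [h0, h1, dotProduct, dotProduct, ← Finset.sum_add_distrib, ← Finset.sum_add_distrib]
  refine Finset.sum_congr rfl fun j _ => ?_
  rw [mixedMatrix_mulVec]
  rcases hj : j.val with _ | _ | m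
  · simp; ring
  · simp; ring
  · simp

open Matrix in
/-- A common eigenvalue of `F_n` and `S_{n,2}` is a root of `b₂ x² - b₁ b₂ x + b₁`. -/
theorem quadratic_of_common_eigenvalue {n : ℕ} (hn : 1 < n) {b₁ b₂ x : ℝ} {u v : Fin n → ℝ}
    (hu0 : u ≠ 0) (hv0 : v ≠ 0) (hu : freeMatrix n *ᵥ u = x • u)
    (hv : mixedMatrix n b₁ b₂ *ᵥ v = x • v) : b₂ * x ^ 2 - b₁ * b₂ * x + b₁ = 0 := by
  let l : Fin n := ⟨n - 1, by omega⟩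
  have hl : ∀ i : Fin n, i.val + 1 = n → i = l := fun i hi => Fin.ext (by simp only [l]; omega)
  have hr : ∀ (w : Fin n → ℝ), schrodingerMatrix n (fun _ => 0) *ᵥ w = freeMatrix n *ᵥ w :=
    fun _ => rfl
  -- The last entry of `z` cancels and both matrices agree from row `2` on, so backward recurrence
  -- leaves only the first entry of `z`. Rows `0` and `1` then give the quadratic.
  set z : Fin n → ℝ := u l • v - v l • u with hz
  have hFz : ∀ i : Fin n, (freeMatrix n *ᵥ z) i = x * z i -
      u l * ((if i.val = 0 then b₁ else if i.val = 1 then b₂ else 0) * v i) := fun i => by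
    have h1 := congrFun hv i
    have h2 := congrFun hu i
    rw [mixedMatrix_mulVec] at h1
    simp only [Pi.smul_apply, smul_eq_mul] at h1 h2
    simp only [hz, mulVec_sub, mulVec_smul, Pi.sub_apply, Pi.smul_apply, smul_eq_mul, h2]
    linear_combination u l * h1
  have hz1 := apply_eq_zero_of_schrodingerMatrix_mulVec_tail (b := fun _ => 0) (v := z) (x := x)
    (fun i hi => by
      rw [hr, hFz, if_neg (by omega), if_neg (by omega)]
      ring)
    (fun i hi => by
      rw [hl i hi, hz]
      simp [mul_comm])
  have hu1 : u ⟨0, by omega⟩ ≠ 0 := fun h =>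
    hu0 (eq_zero_of_schrodingerMatrix_mulVec (b := fun _ => 0) hu (by omega) h)
  have hprev : ∀ w : Fin n → ℝ, (∑ j : Fin n, if j.val + 1 = 0 then w j else 0) = 0 :=
    fun w => by simp
  have hrow0 : ∀ w : Fin n → ℝ, (freeMatrix n *ᵥ w) ⟨0, by omega⟩ = w ⟨1, hn⟩ := fun w => by
    rw [← hr, schrodingerMatrix_mulVec]
    simp only
    rw [hprev, sum_ite_val_eq w (m := 0 + 1) hn]
    ring
  have hux := congrFun hu ⟨0, by omega⟩
  rw [hrow0, Pi.smul_apply, smul_eq_mul] at hux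
  have hz10 := hz1 ⟨1, hn⟩ le_rfl
  have e0 := hFz ⟨0, by omega⟩
  rw [hrow0, hz10] at e0
  have e1 := hFz ⟨1, hn⟩
  rw [← hr, schrodingerMatrix_mulVec, hz10] at e1
  simp only at e1
  rw [sum_ite_succ_eq_succ z (m := 0) (by omega), Finset.sum_eq_zero (fun j _ => by
    split_ifs with hj
    · exact hz1 j (by omega)
    · rfl)] at e1
  have d0 : z ⟨0, by omega⟩ = u l * v ⟨0, by omega⟩ - v l * u ⟨0, by omega⟩ := rfl
  have d1 : z ⟨1, hn⟩ = u l * v ⟨1, hn⟩ - v l * u ⟨1, hn⟩ := rfl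
  simp only [if_true, if_false, one_ne_zero] at e0 e1
  rw [hz10] at d1
  -- Otherwise `v` would live on the first entry alone, which row `1` forces to vanish.
  have hvl : v l ≠ 0 := by
    intro h
    have ht : ∀ i : Fin n, 1 ≤ i.val → v i = 0 :=
      apply_eq_zero_of_schrodingerMatrix_mulVec_tail (x := x)
        (b := fun i => if i.val = 0 then b₁ else if i.val = 1 then b₂ else 0)
        (fun i _ => congrFun hv i) (fun i hi => by rw [hl i hi, h])
    have hv1 := congrFun hv ⟨1, hn⟩
    rw [mixedMatrix, schrodingerMatrix_mulVec] at hv1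
    simp only [Pi.smul_apply] at hv1
    rw [sum_ite_succ_eq_succ v (m := 0) (by omega), ht ⟨1, hn⟩ le_rfl,
      Finset.sum_eq_zero (fun j _ => by
        split_ifs with hj
        · exact ht j (by omega)
        · rfl)] at hv1
    exact hv0 (eq_zero_of_schrodingerMatrix_mulVec hv (by omega) (by simpa using hv1))
  have hfin : v l * u ⟨0, by omega⟩ * (b₂ * x ^ 2 - b₁ * b₂ * x + b₁) = 0 := by
    grind
  exact (mul_eq_zero.mp hfin).resolve_left (mul_ne_zero hvl hu1)

/-! ### Spectral symmetry and strict comparison. -/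

open Matrix in
/-- The spectrum of the free matrix is symmetric about `0`. -/
theorem exists_neg_eigenvector_freeMatrix {n : ℕ} {x : ℝ} {u : Fin n → ℝ} (hu0 : u ≠ 0)
    (hu : freeMatrix n *ᵥ u = x • u) :
    ∃ w : Fin n → ℝ, w ≠ 0 ∧ freeMatrix n *ᵥ w = (-x) • w := by
  -- Neighbouring indices have opposite parity, so alternating signs negate the hopping terms.
  refine ⟨fun i => (-1) ^ i.val * u i, fun h => hu0 ?_, ?_⟩
  · ext i
    simpa using congrFun h i
  · ext i
    have hi := congrFun hu i
    rw [freeMatrix, schrodingerMatrix_mulVec] at hi ⊢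
    have h1 : (∑ j : Fin n, if i.val + 1 = j.val then (-1 : ℝ) ^ j.val * u j else 0) =
        -(-1) ^ i.val * ∑ j : Fin n, if i.val + 1 = j.val then u j else 0 := by
      rw [Finset.mul_sum]
      refine Finset.sum_congr rfl fun j _ => ?_
      split_ifs with hj
      · rw [← hj, pow_succ]; ring
      · ring
    have h2 : (∑ j : Fin n, if j.val + 1 = i.val then (-1 : ℝ) ^ j.val * u j else 0) =
        -(-1) ^ i.val * ∑ j : Fin n, if j.val + 1 = i.val then u j else 0 := by
      rw [Finset.mul_sum]
      refine Finset.sum_congr rfl fun j _ => ?_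
      split_ifs with hj
      · rw [← hj, pow_succ]; ring
      · ring
    rw [h1, h2]
    simp only [Pi.smul_apply, smul_eq_mul] at hi ⊢
    linear_combination -(-1) ^ i.val * hi

/-- The perturbation is semidefinite, so on the vector from
`exists_vector_of_increasingEigenvalues_eq` its form vanishes. That vector is then a free
eigenvector with first entry `0`, which is impossible. -/
theorem increasingEigenvalues_ne_of_pos_or_neg {n : ℕ} (hn : 1 < n) {b₁ b₂ : ℝ}
    (hb : 0 < b₁ ∧ 0 < b₂ ∨ b₁ < 0 ∧ b₂ < 0) (k : Fin n) :
    increasingEigenvalues (freeMatrix_isHermitian n) k ≠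
      increasingEigenvalues (mixedMatrix_isHermitian n b₁ b₂) k := by
  intro h
  rcases hb with ⟨hb₁, hb₂⟩ | ⟨hb₁, hb₂⟩
  · obtain ⟨v, hv0, hA, hB, hAe, -⟩ := exists_vector_of_increasingEigenvalues_eq
      (freeMatrix_isHermitian n) (mixedMatrix_isHermitian n b₁ b₂) k rfl h.symm
    rw [dotProduct_mixedMatrix_mulVec hn] at hB
    have p1 := mul_nonneg hb₁.le (sq_nonneg (v ⟨0, by omega⟩))
    have p2 := mul_nonneg hb₂.le (sq_nonneg (v ⟨1, hn⟩))
    have p3 : b₁ * v ⟨0, by omega⟩ ^ 2 = 0 := by linarith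
    exact hv0 (eq_zero_of_schrodingerMatrix_mulVec (hAe (by linarith)) (by omega)
      (by simpa [hb₁.ne'] using p3))
  · obtain ⟨v, hv0, hA, hB, -, hBe⟩ := exists_vector_of_increasingEigenvalues_eq
      (mixedMatrix_isHermitian n b₁ b₂) (freeMatrix_isHermitian n) k h.symm rfl
    rw [dotProduct_mixedMatrix_mulVec hn] at hA
    have p1 := mul_nonpos_of_nonpos_of_nonneg hb₁.le (sq_nonneg (v ⟨0, by omega⟩))
    have p2 := mul_nonpos_of_nonpos_of_nonneg hb₂.le (sq_nonneg (v ⟨1, hn⟩))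
    have p3 : b₁ * v ⟨0, by omega⟩ ^ 2 = 0 := by linarith
    exact hv0 (eq_zero_of_schrodingerMatrix_mulVec (hBe (by linarith)) (by omega)
      (by simpa [hb₁.ne] using p3))

/-- Consecutive eigenvalues of the free matrix of opposite signs are opposite numbers. -/
theorem add_eq_zero_of_consecutive_freeMatrix {n k : ℕ} (hk : k + 1 < n)
    (hneg : increasingEigenvalues (freeMatrix_isHermitian n) ⟨k, Nat.lt_of_succ_lt hk⟩ < 0)
    (hpos : 0 < increasingEigenvalues (freeMatrix_isHermitian n) ⟨k + 1, hk⟩) :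
    increasingEigenvalues (freeMatrix_isHermitian n) ⟨k, Nat.lt_of_succ_lt hk⟩ +
      increasingEigenvalues (freeMatrix_isHermitian n) ⟨k + 1, hk⟩ = 0 := by
  have hmono := increasingEigenvalues_monotone (freeMatrix_isHermitian n)
  have hgap : ∀ j : Fin n,
      increasingEigenvalues (freeMatrix_isHermitian n) j ≤
        increasingEigenvalues (freeMatrix_isHermitian n) ⟨k, Nat.lt_of_succ_lt hk⟩ ∨
      increasingEigenvalues (freeMatrix_isHermitian n) ⟨k + 1, hk⟩ ≤
        increasingEigenvalues (freeMatrix_isHermitian n) j := fun j => by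
    rcases Nat.lt_or_ge k j.val with h | h
    · exact Or.inr (hmono (Fin.le_def.mpr h))
    · exact Or.inl (hmono (Fin.le_def.mpr h))
  have hsymm : ∀ i : Fin n, ∃ j, increasingEigenvalues (freeMatrix_isHermitian n) j =
      -increasingEigenvalues (freeMatrix_isHermitian n) i := fun i => by
    obtain ⟨u, hu0, hu⟩ := exists_eigenvector_increasingEigenvalues (freeMatrix_isHermitian n) i
    obtain ⟨w, hw0, hw⟩ := exists_neg_eigenvector_freeMatrix hu0 hu
    exact exists_increasingEigenvalues_eq (freeMatrix_isHermitian n) hw0 hw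
  obtain ⟨j₁, hj₁⟩ := hsymm ⟨k, Nat.lt_of_succ_lt hk⟩
  obtain ⟨j₂, hj₂⟩ := hsymm ⟨k + 1, hk⟩
  -- The negatives of the two eigenvalues also avoid the open gap between them, which bounds their
  -- sum from both sides by `0`.
  rcases hgap j₁ with h | h <;> rcases hgap j₂ with h' | h' <;> linarith

/-- If `S_{n,2}` and `F_n` have the same eigenvalue in two consecutive positions (positions `k + 1`
and `k + 2` of the increasing enumerations), then `b₁ = b₂ = 0`, i.e. `S_{n,2} = F_n`. -/
theorem mainTheorem1 (n : ℕ) (b₁ b₂ : ℝ) (k : ℕ) (hk : k + 1 < n)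
    (h₁ : increasingEigenvalues (freeMatrix_isHermitian n) ⟨k, Nat.lt_of_succ_lt hk⟩ =
      increasingEigenvalues (mixedMatrix_isHermitian n b₁ b₂) ⟨k, Nat.lt_of_succ_lt hk⟩)
    (h₂ : increasingEigenvalues (freeMatrix_isHermitian n) ⟨k + 1, hk⟩ =
      increasingEigenvalues (mixedMatrix_isHermitian n b₁ b₂) ⟨k + 1, hk⟩) :
    (b₁ = 0 ∧ b₂ = 0) ∧ mixedMatrix n b₁ b₂ = freeMatrix n := by
  suffices hb : b₁ = 0 ∧ b₂ = 0 by
    refine ⟨hb, ?_⟩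
    simp [mixedMatrix, freeMatrix, hb.1, hb.2]
  have hn : 1 < n := by omega
  have hquad : ∀ i : Fin n, increasingEigenvalues (freeMatrix_isHermitian n) i =
      increasingEigenvalues (mixedMatrix_isHermitian n b₁ b₂) i →
      b₂ * increasingEigenvalues (freeMatrix_isHermitian n) i ^ 2 -
        b₁ * b₂ * increasingEigenvalues (freeMatrix_isHermitian n) i + b₁ = 0 := fun i hi => by
    obtain ⟨u, hu0, hu⟩ := exists_eigenvector_increasingEigenvalues (freeMatrix_isHermitian n) i
    obtain ⟨v, hv0, hv⟩ :=
      exists_eigenvector_increasingEigenvalues (mixedMatrix_isHermitian n b₁ b₂) i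
    exact quadratic_of_common_eigenvalue hn hu0 hv0 hu (hi ▸ hv)
  have q₁ := hquad _ h₁
  have q₂ := hquad _ h₂
  have hne := increasingEigenvalues_ne_of_pos_or_neg (b₁ := b₁) (b₂ := b₂) hn
  have hlt : increasingEigenvalues (freeMatrix_isHermitian n) ⟨k, Nat.lt_of_succ_lt hk⟩ <
      increasingEigenvalues (freeMatrix_isHermitian n) ⟨k + 1, hk⟩ :=
    increasingEigenvalues_schrodingerMatrix_strictMono _ (Fin.lt_def.mpr (Nat.lt_succ_self k))
  have hopp := add_eq_zero_of_consecutive_freeMatrix hk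
  replace hne := fun hb => hne hb ⟨k, Nat.lt_of_succ_lt hk⟩ h₁
  clear h₁ h₂ hquad
  generalize increasingEigenvalues (freeMatrix_isHermitian n) ⟨k, Nat.lt_of_succ_lt hk⟩ = x at *
  generalize increasingEigenvalues (freeMatrix_isHermitian n) ⟨k + 1, hk⟩ = y at *
  by_cases hb₂ : b₂ = 0
  · subst hb₂
    exact ⟨by linarith, rfl⟩
  exfalso
  have hsum : x + y = b₁ := by
    -- Vieta's formulas, by subtracting the two quadratics.
    have h : b₂ * (y - x) * (x + y - b₁) = 0 := by linear_combination q₂ - q₁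
    rcases mul_eq_zero.mp h with h | h
    · exact absurd h (mul_ne_zero hb₂ (sub_ne_zero.mpr hlt.ne'))
    · linarith
  have hprod : b₁ = b₂ * (x * y) := by
    linear_combination q₁ - b₂ * x * hsum
  have hb₁ : b₁ ≠ 0 := fun h => by
    subst h
    have hx : b₂ * x ^ 2 = 0 := by linarith
    have hy : b₂ * y ^ 2 = 0 := by linarith
    simp only [mul_eq_zero, hb₂, false_or, pow_eq_zero_iff two_ne_zero] at hx hy
    exact hlt.ne (hx.trans hy.symm)
  rcases lt_trichotomy (x * y) 0 with h | h | h
  · rcases mul_neg_iff.mp h with ⟨hx, hy⟩ | ⟨hx, hy⟩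
    · linarith
    · exact hb₁ (hsum ▸ hopp hx hy)
  · exact hb₁ (by rw [hprod, h, mul_zero])
  · rcases lt_or_gt_of_ne hb₂ with hs | hs
    · exact hne (Or.inr ⟨hprod ▸ mul_neg_of_neg_of_pos hs h, hs⟩)
    · exact hne (Or.inl ⟨hprod ▸ mul_pos hs h, hs⟩)
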